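/- Let $d\ge 1$ and, for $j=1,\dots,d$, let $\underline\nu_j,\overline\nu_j$ be Borel probability measures on $\mathbb R$ with $\underline\nu_j\preceq_1\overline\nu_j$, where $\nu\preceq_1\nu'$ means $\nu((-\infty,t])\ge\nu'((-\infty,t])$ for all $t\in\mathbb R$. Let $I$ be an arbitrary index set and, for each $i\in I$, let $\underline\pi^i\in[0,1]$ and $A^i=(-\infty,A^i_1]\times\dots\times(-\infty,A^i_d]$ with $A^i_1,\dots,A^i_d\in\mathbb R$. For $f\colon\mathbb R^d\to\mathbb R$ let $\Theta_1(f)$ be the set of all $(f_1,g_1,\dots,f_d,g_d,a)$ such that $f_j,g_j\colon\mathbb R\to\mathbb R$ are non-decreasing, bounded and continuous, $a=(a^i)_{i\in I}$ is a family of reals $a^i\le 0$ with $a^i=0$ for all but finitely many $i$, and $$\sum_{j=1}^d\big(f_j(x_j)-g_j(x_j)\big)+\sum_{i\in I}a^i1_{A^i}(x)\ge f(x)\qquad\text{for all }x\in\mathbb R^d,$$ and put $$\phi_1(f):=\inf_{(f_1,g_1,\dots,f_d,g_d,a)\in\Theta_1(f)}\Big\{\sum_{j=1}^d\Big(\int_{\mathbb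 R} f_j\,\mathrm d\overline\nu_j-\int_{\mathbb R} g_j\,\mathrm d\underline\nu_j\Big)+\sum_{i\in I}a^i\underline\pi^i\Big\}\in[-\infty,\infty].$$ Let $\mathcal Q_1$ be the set of Borel probability measures $\mu$ on $\mathbb R^d$ with $\mu(A^i)\ge\underline\pi^i$ for all $i\in I$ and whose marginals $\mu_1,\dots,\mu_d$ satisfy $\underline\nu_j\preceq_1\mu_j\preceq_1\overline\nu_j$ for all $j$. Let $f\colon\mathbb R^d\to\mathbb R$ be bounded and upper semicontinuous. If $\phi_1(\varepsilon)>0$ for every (constant) $\varepsilon>0$, then $$\phi_1(f)=\sup_{\mu\in\mathcal Q_1}\int_{\mathbb R^d}f\,\mathrm d\mu$$ (with $\sup\emptyset=-\infty$). -/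

import Mathlib

open MeasureTheory
open scoped BoundedContinuousFunction

namespace FOSDDuality

/-- First-order stochastic dominance `ν ⪯₁ ν'` on the real line:
`ν (-∞, t] ≥ ν' (-∞, t]` for every `t` (so `ν'` dominates `ν`). -/
def FirstOrderLE (ν ν' : Measure ℝ) : Prop :=
  ∀ t : ℝ, ν' (Set.Iic t) ≤ ν (Set.Iic t)

/-- Trading strategies `(f₁, g₁, …, f_d, g_d, a)`: every `f_j` and `g_j` is a non-decreasing bounded
continuous function on the real line, and `a` is a finitely supported family of reals `a i ≤ 0`. -/
structure Strategy (d : ℕ) (I : Type*) where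
  f : Fin d → (ℝ →ᵇ ℝ)
  g : Fin d → (ℝ →ᵇ ℝ)
  a : I →₀ ℝ
  monotone_f : ∀ j, Monotone (f j)
  monotone_g : ∀ j, Monotone (g j)
  a_nonpos : ∀ i, a i ≤ 0

/-- The box `(-∞, b₁] × ⋯ × (-∞, b_d]`. -/
def lowerBox {d : ℕ} (b : Fin d → ℝ) : Set (Fin d → ℝ) :=
  {x | ∀ j, x j ≤ b j}

/-- The terminal value `∑ j, (f_j (x_j) - g_j (x_j)) + ∑ i, a^i 1_{A^i} (x)` of a strategy, where
`A^i` is the box with upper corner `A i`. -/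
noncomputable def Strategy.payoff {d : ℕ} {I : Type*} (A : I → Fin d → ℝ) (s : Strategy d I)
    (x : Fin d → ℝ) : ℝ :=
  ∑ j, (s.f j (x j) - s.g j (x j)) +
    ∑ i ∈ s.a.support, s.a i * (lowerBox (A i)).indicator (fun _ => (1 : ℝ)) x

/-- The price `∑ j, (∫ f_j dν̄_j - ∫ g_j dν̲_j) + ∑ i, a^i π̲^i` of a strategy. The arguments
`νlo`, `νhi`, `πlo` are the families `ν̲`, `ν̄`, `π̲`. -/
noncomputable def Strategy.price {d : ℕ} {I : Type*} (νlo νhi : Fin d → ProbabilityMeasure ℝ)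
    (πlo : I → ℝ) (s : Strategy d I) : ℝ :=
  ∑ j, (∫ t, s.f j t ∂(νhi j : Measure ℝ) - ∫ t, s.g j t ∂(νlo j : Measure ℝ)) +
    ∑ i ∈ s.a.support, s.a i * πlo i

/-- The set `Θ₁(F)` of strategies whose terminal value dominates `F` everywhere. -/
def Theta1 {d : ℕ} {I : Type*} (A : I → Fin d → ℝ) (F : (Fin d → ℝ) → ℝ) : Set (Strategy d I) :=
  {s | ∀ x, F x ≤ s.payoff A x}

/-- The superhedging value `φ₁(F)`, the infimum of the prices over `Θ₁(F)`, as an extended real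
(it may be `-∞`). -/
noncomputable def phi1 {d : ℕ} {I : Type*} (νlo νhi : Fin d → ProbabilityMeasure ℝ)
    (A : I → Fin d → ℝ) (πlo : I → ℝ) (F : (Fin d → ℝ) → ℝ) : EReal :=
  ⨅ s ∈ Theta1 A F, ((s.price νlo νhi πlo : ℝ) : EReal)

/-- The set `Q₁` of Borel probability measures `μ` on `ℝ^d` whose marginals `μ_j` satisfy
`ν̲_j ⪯₁ μ_j ⪯₁ ν̄_j` and with `μ(A^i) ≥ π̲^i` for all `i`. -/
def Q1 {d : ℕ} {I : Type*} (νlo νhi : Fin d → ProbabilityMeasure ℝ)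
    (A : I → Fin d → ℝ) (πlo : I → ℝ) : Set (ProbabilityMeasure (Fin d → ℝ)) :=
  {μ | (∀ j, FirstOrderLE (νlo j) ((μ : Measure (Fin d → ℝ)).map (fun x => x j)) ∧
        FirstOrderLE ((μ : Measure (Fin d → ℝ)).map (fun x => x j)) (νhi j)) ∧
      ∀ i, πlo i ≤ (μ : Measure (Fin d → ℝ)).real (lowerBox (A i))}

end FOSDDuality

/-! The value `phi1` is a sublinear functional on bounded functions. Positivity on positive
constants, combined with cash positions, upgrades to: a payoff bounded below by `c` costs at least
`c`, so the value is finite. Hahn–Banach (`exists_linearMap_le_price`) then yields a linear `Λ`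
below the price of every superhedge, attaining the superhedging value at `f`.

Testing `Λ` on elementary strategies reads off a measure (`exists_mem_Q1_le_integral`). Cash makes
`Λ` positive and normalised, long and short positions sandwich its marginals, and short boxes give
`Λ 1_{A^i} ≥ π̲^i`. The marginal bounds prevent mass from escaping to infinity, so Riesz represents
`Λ` by a probability measure `μ` on bounded continuous functions. On a bounded upper semicontinuous
`F` only `Λ F ≤ ∫ F dμ` survives, by approximation from above, but this is the direction needed both
for the boxes, which are closed, and for `f`. The converse inequality integrates the superhedge
(`integral_le_price`). -/

namespace FOSDDuality

open Filter Topology CompactlySupported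

/-! ### Riesz representation of tight positive functionals -/

/-- A positive normalised linear functional which is tight, in the sense that it is continuous along
a sequence of compactly supported cutoffs, is represented on bounded continuous functions by a
probability measure. -/
theorem exists_probabilityMeasure_integral_eq {X : Type*} [TopologicalSpace X] [T2Space X]
    [LocallyCompactSpace X] [MeasurableSpace X] [BorelSpace X]
    (Λ : (X → ℝ) →ₗ[ℝ] ℝ)
    (hpos : ∀ F : X → ℝ, (∃ C, ∀ x, |F x| ≤ C) → (∀ x, 0 ≤ F x) → 0 ≤ Λ F)
    (hone : Λ (fun _ => 1) = 1)
    (χ : ℕ → C_c(X, ℝ)) (hχ0 : ∀ n x, 0 ≤ χ n x) (hχ1 : ∀ n x, χ n x ≤ 1)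
    (hχ : ∀ x, Tendsto (fun n => χ n x) atTop (𝓝 1))
    (hΛχ : Tendsto (fun n => Λ (χ n)) atTop (𝓝 1)) :
    ∃ μ : ProbabilityMeasure X, ∀ h : X →ᵇ ℝ, ∫ x, h x ∂(μ : Measure X) = Λ h := by
  have hbdd : ∀ g : C_c(X, ℝ), ∃ C, ∀ x, |g x| ≤ C := fun g => by
    obtain ⟨C, hC⟩ := g.hasCompactSupport.exists_bound_of_continuous g.continuous
    exact ⟨C, hC⟩
  let Λc : C_c(X, ℝ) →ₚ[ℝ] ℝ := PositiveLinearMap.mk₀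
    { toFun := fun g => Λ g
      map_add' := fun g h => by rw [CompactlySupportedContinuousMap.coe_add, map_add]
      map_smul' := fun c g => by
        rw [CompactlySupportedContinuousMap.coe_smul, map_smul, RingHom.id_apply] }
    (fun g hg => hpos g (hbdd g) hg)
  set μ := RealRMK.rieszMeasure Λc
  have hint : ∀ g : C_c(X, ℝ), ∫ x, g x ∂μ = Λ g := fun g => RealRMK.integral_rieszMeasure Λc g
  have hmono : ∀ F G : X → ℝ, (∃ C, ∀ x, |G x - F x| ≤ C) → (∀ x, F x ≤ G x) → Λ F ≤ Λ G := by
    intro F G hb hFG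
    have := hpos (G - F) hb (fun x => sub_nonneg.2 (hFG x))
    rw [map_sub] at this
    linarith
  have hχle : ∀ n, Λ (χ n) ≤ 1 := fun n => by
    rw [← hone]
    refine hmono _ _ ⟨1, fun x => ?_⟩ (hχ1 n)
    rw [abs_le]
    constructor <;> linarith [hχ0 n x, hχ1 n x]
  have hchi_int : ∀ n, Integrable (χ n) μ := fun n =>
    (χ n).continuous.integrable_of_hasCompactSupport (χ n).hasCompactSupport
  -- Fatou along the cutoffs gives finiteness, needed for dominated convergence below; mass exactly
  -- one follows later from `h = 1`.
  have hfin : μ Set.univ ≤ 1 := by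
    calc μ Set.univ = ∫⁻ x, liminf (fun n => ENNReal.ofReal (χ n x)) atTop ∂μ := by
          rw [← lintegral_one]
          refine lintegral_congr fun x => ?_
          have : Tendsto (fun n => ENNReal.ofReal (χ n x)) atTop (𝓝 (ENNReal.ofReal 1)) :=
            (ENNReal.continuous_ofReal.tendsto 1).comp (hχ x)
          rw [this.liminf_eq, ENNReal.ofReal_one]
      _ ≤ liminf (fun n => ∫⁻ x, ENNReal.ofReal (χ n x) ∂μ) atTop :=
          lintegral_liminf_le fun n => ((χ n).continuous.measurable).ennreal_ofReal
      _ ≤ liminf (fun _ => 1) (atTop : Filter ℕ) := by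
          refine liminf_le_liminf (Eventually.of_forall fun n => ?_)
          rw [← ofReal_integral_eq_lintegral_ofReal (hchi_int n) (Eventually.of_forall (hχ0 n)),
            hint (χ n)]
          exact ENNReal.ofReal_le_one.2 (hχle n)
      _ = 1 := by simp
  have : IsFiniteMeasure μ := ⟨hfin.trans_lt ENNReal.one_lt_top⟩
  have hrep : ∀ h : X →ᵇ ℝ, ∫ x, h x ∂μ = Λ h := by
    intro h
    have hhc : ∀ x, |h x| ≤ ‖h‖ := fun x => h.norm_coe_le_norm x
    let hn : ℕ → C_c(X, ℝ) := fun n =>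
      ⟨⟨fun x => h x * χ n x, h.continuous.mul (χ n).continuous⟩,
        (χ n).hasCompactSupport.mul_left⟩
    have hn_apply : ∀ n x, hn n x = h x * χ n x := fun n x => rfl
    have t1 : Tendsto (fun n => ∫ x, hn n x ∂μ) atTop (𝓝 (∫ x, h x ∂μ)) := by
      refine tendsto_integral_of_dominated_convergence (fun _ => ‖h‖)
        (fun n => (hn n).continuous.measurable.aestronglyMeasurable) (integrable_const _)
        (fun n => Eventually.of_forall fun x => ?_) (Eventually.of_forall fun x => ?_)
      · rw [hn_apply, norm_mul, Real.norm_eq_abs, Real.norm_eq_abs, abs_of_nonneg (hχ0 n x)]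
        exact (mul_le_of_le_one_right (abs_nonneg _) (hχ1 n x)).trans (hhc x)
      · simpa [hn_apply] using (hχ x).const_mul (h x)
    -- Tightness enters here: `|h χ_n - h| ≤ ‖h‖ (1 - χ_n)`, and `Λ (1 - χ_n)` tends to `0`.
    have t2 : Tendsto (fun n => Λ (hn n)) atTop (𝓝 (Λ h)) := by
      rw [tendsto_iff_norm_sub_tendsto_zero]
      have h0 : Tendsto (fun n => ‖h‖ * (1 - Λ (χ n))) atTop (𝓝 0) := by
        simpa using (hΛχ.const_sub 1).const_mul ‖h‖
      refine squeeze_zero (fun _ => norm_nonneg _) (fun n => ?_) h0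
      have key : ∀ x, |h x * χ n x - h x| ≤ ‖h‖ * (1 - χ n x) := fun x => by
        have : h x * χ n x - h x = - (h x * (1 - χ n x)) := by ring
        rw [this, abs_neg, abs_mul, abs_of_nonneg (sub_nonneg.2 (hχ1 n x))]
        exact mul_le_mul_of_nonneg_right (hhc x) (sub_nonneg.2 (hχ1 n x))
      have eqΛ : ‖h‖ * (1 - Λ (χ n)) = Λ (‖h‖ • ((fun _ => 1) - ⇑(χ n))) := by
        rw [map_smul, map_sub, hone, smul_eq_mul]
      have hb2 : ∀ x, ‖h‖ * (1 - χ n x) ≤ ‖h‖ := fun x =>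
        mul_le_of_le_one_right (norm_nonneg _) (by linarith [hχ0 n x])
      rw [Real.norm_eq_abs, ← map_sub, abs_le, eqΛ, ← map_neg]
      constructor
      · refine hmono _ _ ⟨2 * ‖h‖, fun x => ?_⟩ fun x => ?_
        · have := abs_le.1 (key x)
          have := hb2 x
          simp only [Pi.sub_apply, Pi.neg_apply, Pi.smul_apply, smul_eq_mul, hn_apply]
          rw [abs_le]
          constructor <;> linarith
        · simpa [hn_apply] using (abs_le.1 (key x)).1
      · refine hmono _ _ ⟨2 * ‖h‖, fun x => ?_⟩ fun x => ?_
        · have := abs_le.1 (key x)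
          have := hb2 x
          simp only [Pi.sub_apply, Pi.smul_apply, smul_eq_mul, hn_apply]
          rw [abs_le]
          constructor <;> linarith
        · simpa [hn_apply] using (abs_le.1 (key x)).2
    exact tendsto_nhds_unique t1 (by simpa only [hint] using t2)
  have hprob : IsProbabilityMeasure μ := by
    have h1 := hrep (BoundedContinuousFunction.const X 1)
    have h2 : Λ (BoundedContinuousFunction.const X (1 : ℝ)) = 1 := hone
    rw [h2] at h1
    simp only [BoundedContinuousFunction.const_apply, integral_const, smul_eq_mul, mul_one] at h1
    refine ⟨?_⟩
    rw [← ENNReal.toReal_eq_one_iff]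
    exact h1
  exact ⟨⟨μ, hprob⟩, hrep⟩

/-! ### Upper semicontinuous functions as limits of continuous majorants -/

/-- The sup-convolution `x ↦ ⨆ y, F y - n d(x, y)`. -/
noncomputable def supConv {X : Type*} [PseudoMetricSpace X] (F : X → ℝ) (n : ℕ) (x : X) : ℝ :=
  ⨆ y, (F y - n * dist x y)

section SupConv

variable {X : Type*} [PseudoMetricSpace X] {F : X → ℝ} {C : ℝ}

/-- A real `⨆` over an unbounded family takes a default value, so lower estimates of `supConv` need
this bound. -/
theorem bddAbove_range_sub_mul_dist (hF : ∀ x, |F x| ≤ C) (n : ℕ) (x : X) :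
    BddAbove (Set.range fun y => F y - n * dist x y) := by
  refine ⟨C, ?_⟩
  rintro _ ⟨y, rfl⟩
  have : (0 : ℝ) ≤ n * dist x y := by positivity
  have := (abs_le.1 (hF y)).2
  dsimp only
  linarith

theorem le_supConv (hF : ∀ x, |F x| ≤ C) (n : ℕ) (x : X) : F x ≤ supConv F n x := by
  have h := le_ciSup (bddAbove_range_sub_mul_dist hF n x) x
  simp only [dist_self, mul_zero, sub_zero] at h
  exact h

theorem supConv_le (hF : ∀ x, |F x| ≤ C) (n : ℕ) (x : X) : supConv F n x ≤ C := by
  have : Nonempty X := ⟨x⟩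
  refine ciSup_le fun y => ?_
  have : (0 : ℝ) ≤ n * dist x y := by positivity
  have := (abs_le.1 (hF y)).2
  linarith

/-- Each function under the supremum is `n`-Lipschitz in `x`, and the supremum inherits the
constant. -/
theorem continuous_supConv (hF : ∀ x, |F x| ≤ C) (n : ℕ) : Continuous (supConv F n) := by
  refine (LipschitzWith.of_le_add_mul n fun x z => ?_).continuous
  have : Nonempty X := ⟨x⟩
  refine ciSup_le fun y => ?_
  have h1 := le_ciSup (bddAbove_range_sub_mul_dist hF n z) y
  have h2 : (n : ℝ) * dist z y ≤ n * (dist x z + dist x y) :=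
    mul_le_mul_of_nonneg_left (by rw [dist_comm x z]; exact dist_triangle z x y) (by positivity)
  change _ ≤ supConv F n z + _
  change _ ≤ supConv F n z at h1
  simp only [NNReal.coe_natCast]
  linarith

theorem abs_supConv_le (hF : ∀ x, |F x| ≤ C) (n : ℕ) (x : X) : |supConv F n x| ≤ C :=
  abs_le.2 ⟨(abs_le.1 (hF x)).1.trans (le_supConv hF n x), supConv_le hF n x⟩

/-- Near `x`, semicontinuity keeps `F` below `b`; at distance at least `δ`, the penalty `n δ`
exceeds `C - b` once `n` is large. -/
theorem tendsto_supConv (hF : ∀ x, |F x| ≤ C) (husc : UpperSemicontinuous F) (x : X) :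
    Tendsto (fun n => supConv F n x) atTop (𝓝 (F x)) := by
  rw [tendsto_order]
  refine ⟨fun a ha => Eventually.of_forall fun n => ha.trans_le (le_supConv hF n x), ?_⟩
  intro a ha
  obtain ⟨b, hb, hba⟩ := exists_between ha
  obtain ⟨δ, hδ, hball⟩ := Metric.eventually_nhds_iff.1 (husc x b hb)
  obtain ⟨N, hN⟩ := exists_nat_gt ((C - b) / δ)
  filter_upwards [eventually_ge_atTop N] with n hn
  have : Nonempty X := ⟨x⟩
  refine lt_of_le_of_lt (ciSup_le fun y => ?_) hba
  have h0 : (0 : ℝ) ≤ n * dist x y := by positivity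
  rcases lt_or_ge (dist y x) δ with hy | hy
  · linarith [hball hy]
  · have h1 : (C - b) < n * δ := by
      rw [div_lt_iff₀ hδ] at hN
      refine hN.trans_le (mul_le_mul_of_nonneg_right (by exact_mod_cast hn) hδ.le)
    have h2 : (n : ℝ) * δ ≤ n * dist x y :=
      mul_le_mul_of_nonneg_left (by rwa [dist_comm]) (by positivity)
    linarith [(abs_le.1 (hF y)).2]

end SupConv

/-- A monotone functional represented on bounded continuous functions by a probability measure is
dominated by the integral on bounded upper semicontinuous functions. -/
theorem le_integral_of_upperSemicontinuous {X : Type*} [PseudoMetricSpace X] [MeasurableSpace X]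
    [BorelSpace X] {Λ : (X → ℝ) → ℝ} {μ : Measure X} [IsFiniteMeasure μ]
    (hmono : ∀ F G : X → ℝ, (∃ C, ∀ x, |F x| ≤ C) → (∃ C, ∀ x, |G x| ≤ C) → (∀ x, F x ≤ G x) →
      Λ F ≤ Λ G)
    (hΛ : ∀ h : X →ᵇ ℝ, ∫ x, h x ∂μ = Λ h) {F : X → ℝ} (hF : ∃ C, ∀ x, |F x| ≤ C)
    (husc : UpperSemicontinuous F) : Λ F ≤ ∫ x, F x ∂μ := by
  obtain ⟨C, hC⟩ := hF
  have t : Tendsto (fun n => ∫ x, supConv F n x ∂μ) atTop (𝓝 (∫ x, F x ∂μ)) :=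
    tendsto_integral_of_dominated_convergence (fun _ => C)
      (fun n => (continuous_supConv hC n).measurable.aestronglyMeasurable) (integrable_const _)
      (fun n => Eventually.of_forall fun x => abs_supConv_le hC n x)
      (Eventually.of_forall fun x => tendsto_supConv hC husc x)
  -- The limit is taken only under the integral, so no sequential continuity of `Λ` is required.
  refine ge_of_tendsto' t fun n => ?_
  have h := hΛ (BoundedContinuousFunction.ofNormedAddCommGroup (supConv F n)
    (continuous_supConv hC n) C (abs_supConv_le hC n))
  simp only [BoundedContinuousFunction.coe_ofNormedAddCommGroup] at h
  rw [h]
  exact hmono _ _ ⟨C, hC⟩ ⟨C, abs_supConv_le hC n⟩ (le_supConv hC n)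

/-! ### First-order dominance through monotone test functions -/

/-- The piecewise linear ramp rising from `0` at `t` to `1` at `t + 1 / k`. -/
noncomputable def ramp (k t : ℝ) : ℝ →ᵇ ℝ :=
  BoundedContinuousFunction.ofNormedAddCommGroup (fun x => max 0 (min 1 (k * (x - t))))
    (by fun_prop) 1 (fun x => by
      rw [Real.norm_eq_abs, abs_le]
      exact ⟨le_trans (by norm_num) (le_max_left _ _), max_le zero_le_one (min_le_left _ _)⟩)

theorem ramp_apply (k t : ℝ) (x : ℝ) :
    ramp k t x = max 0 (min 1 (k * (x - t))) := rfl

theorem monotone_ramp {k t : ℝ} (hk : 0 ≤ k) : Monotone (ramp k t) := fun x y hxy => by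
  simp only [ramp_apply]
  gcongr

theorem ramp_nonneg (k t : ℝ) (x : ℝ) : 0 ≤ ramp k t x := le_max_left _ _

theorem ramp_le_one (k t : ℝ) (x : ℝ) : ramp k t x ≤ 1 :=
  max_le zero_le_one (min_le_left _ _)

theorem ramp_eq_zero {k t : ℝ} (hk : 0 ≤ k) {x : ℝ} (hx : x ≤ t) : ramp k t x = 0 := by
  rw [ramp_apply, max_eq_left]
  exact (min_le_right _ _).trans (mul_nonpos_of_nonneg_of_nonpos hk (by linarith))

theorem ramp_eq_one {k t : ℝ} {x : ℝ} (hx : 1 ≤ k * (x - t)) : ramp k t x = 1 := by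
  rw [ramp_apply, min_eq_left hx, max_eq_right zero_le_one]

/-- First-order dominance is implied by the inequality of integrals of non-decreasing bounded
continuous functions. -/
theorem firstOrderLE_of_integral_le {ν ν' : Measure ℝ} [IsProbabilityMeasure ν]
    [IsProbabilityMeasure ν'] (h : ∀ F : ℝ →ᵇ ℝ, Monotone F → ∫ t, F t ∂ν ≤ ∫ t, F t ∂ν') :
    FirstOrderLE ν ν' := by
  intro t
  -- The ramps vanish at `t` itself, so they converge to the indicator of the open half-line;
  -- complements then give `Iic t`.
  have lim : ∀ (ρ : Measure ℝ) [IsProbabilityMeasure ρ],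
      Tendsto (fun n : ℕ => ∫ x, ramp n t x ∂ρ) atTop (𝓝 (ρ.real (Set.Ioi t))) := by
    intro ρ _
    rw [← integral_indicator_one measurableSet_Ioi]
    refine tendsto_integral_of_dominated_convergence (fun _ => 1)
      (fun n => (ramp n t).continuous.measurable.aestronglyMeasurable)
      (integrable_const _) (fun n => Eventually.of_forall fun x => ?_)
      (Eventually.of_forall fun x => ?_)
    · rw [Real.norm_eq_abs, abs_of_nonneg (ramp_nonneg _ _ _)]
      exact ramp_le_one _ _ _
    · rcases le_or_gt x t with hx | hx
      · rw [Set.indicator_of_notMem (by simpa using hx)]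
        simp only [fun n : ℕ => ramp_eq_zero (Nat.cast_nonneg (α := ℝ) n) hx, tendsto_const_nhds]
      · rw [Set.indicator_of_mem (by simpa using hx)]
        obtain ⟨N, hN⟩ := exists_nat_ge (1 / (x - t))
        refine tendsto_const_nhds.congr' ?_
        filter_upwards [eventually_ge_atTop N] with n hn
        rw [ramp_eq_one, Pi.one_apply]
        rw [div_le_iff₀ (by linarith)] at hN
        refine hN.trans (mul_le_mul_of_nonneg_right (by exact_mod_cast hn) (by linarith))
  have key : ν.real (Set.Ioi t) ≤ ν'.real (Set.Ioi t) :=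
    le_of_tendsto_of_tendsto' (lim ν) (lim ν') fun n => h _ (monotone_ramp n.cast_nonneg)
  rw [← Set.compl_Iic, probReal_compl_eq_one_sub measurableSet_Iic,
    probReal_compl_eq_one_sub measurableSet_Iic] at key
  rw [← ENNReal.toReal_le_toReal (measure_ne_top _ _) (measure_ne_top _ _)]
  change ν'.real _ ≤ ν.real _
  linarith

/-- First-order dominance gives the inequality of integrals of non-decreasing bounded continuous
functions. -/
theorem FirstOrderLE.integral_le {ν ν' : Measure ℝ} [IsProbabilityMeasure ν]
    [IsProbabilityMeasure ν'] (h : FirstOrderLE ν ν') (F : ℝ →ᵇ ℝ) (hF : Monotone F) :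
    ∫ t, F t ∂ν ≤ ∫ t, F t ∂ν' := by
  -- Superlevel sets of a monotone continuous function are open upper sets: empty, everything, or an
  -- open half-line. The layer-cake formula then compares the integrals.
  have hopen : ∀ s : Set ℝ, IsUpperSet s → IsOpen s → ν s ≤ ν' s := by
    intro s hs hso
    rcases s.eq_empty_or_nonempty with rfl | hne
    · simp
    by_cases huniv : s = Set.univ
    · simp [huniv]
    obtain ⟨b, hb⟩ := (Set.ne_univ_iff_exists_notMem s).1 huniv
    have hbdd : BddBelow s := ⟨b, fun x hx => le_of_not_gt fun hxb => hb (hs hxb.le hx)⟩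
    have hsIoi : s = Set.Ioi (sInf s) := by
      ext x
      constructor
      · intro hx
        obtain ⟨y, hyx, hy⟩ := exists_Ioc_subset_of_mem_nhds (hso.mem_nhds hx) ⟨x - 1, by linarith⟩
        obtain ⟨z, hz⟩ := exists_between hyx
        exact (csInf_le hbdd (hy ⟨hz.1, hz.2.le⟩)).trans_lt hz.2
      · intro hx
        obtain ⟨y, hy, hyx⟩ := (csInf_lt_iff hbdd hne).1 hx
        exact hs hyx.le hy
    rw [hsIoi, ← Set.compl_Iic, prob_compl_eq_one_sub measurableSet_Iic,
      prob_compl_eq_one_sub measurableSet_Iic]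
    exact tsub_le_tsub_left (h _) 1
  -- The layer-cake formula needs a non-negative integrand; the shift cancels since both masses are
  -- one.
  have hnn : ∀ x, 0 ≤ F x + ‖F‖ := fun x => by
    linarith [(abs_le.1 (F.norm_coe_le_norm x)).1]
  have hcont : Continuous fun x => F x + ‖F‖ := F.continuous.add continuous_const
  have hint : ∀ (ρ : Measure ℝ) [IsProbabilityMeasure ρ],
      ∫ x, (F x + ‖F‖) ∂ρ = ∫ x, F x ∂ρ + ‖F‖ := fun ρ _ => by
    rw [integral_add (F.integrable ρ) (integrable_const _)]
    simp
  have key : ∫⁻ x, ENNReal.ofReal (F x + ‖F‖) ∂ν ≤ ∫⁻ x, ENNReal.ofReal (F x + ‖F‖) ∂ν' := by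
    rw [lintegral_eq_lintegral_meas_lt ν (Eventually.of_forall hnn) hcont.measurable.aemeasurable,
      lintegral_eq_lintegral_meas_lt ν' (Eventually.of_forall hnn) hcont.measurable.aemeasurable]
    refine lintegral_mono fun t => hopen _ (fun x y hxy hx => ?_)
      (isOpen_lt continuous_const hcont)
    have := hF hxy
    simp only [Set.mem_ofPred_eq] at hx ⊢
    linarith
  have hint' : ∀ (ρ : Measure ℝ) [IsProbabilityMeasure ρ],
      Integrable (fun x => F x + ‖F‖) ρ := fun ρ _ => (F.integrable ρ).add (integrable_const _)
  rw [← ofReal_integral_eq_lintegral_ofReal (hint' ν) (Eventually.of_forall hnn),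
    ← ofReal_integral_eq_lintegral_ofReal (hint' ν') (Eventually.of_forall hnn),
    ENNReal.ofReal_le_ofReal_iff (integral_nonneg hnn), hint, hint] at key
  linarith

/-! ### The convex cone of strategies and its elementary members -/

namespace Strategy

variable {d : ℕ} {I : Type*}

/-- The sum of two strategies. -/
noncomputable def add (s t : Strategy d I) : Strategy d I where
  f j := s.f j + t.f j
  g j := s.g j + t.g j
  a := s.a + t.a
  monotone_f j := (s.monotone_f j).add (t.monotone_f j)
  monotone_g j := (s.monotone_g j).add (t.monotone_g j)
  a_nonpos i := add_nonpos (s.a_nonpos i) (t.a_nonpos i)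

/-- A non-negative multiple of a strategy. -/
noncomputable def scale (c : ℝ) (hc : 0 ≤ c) (s : Strategy d I) : Strategy d I where
  f j := c • s.f j
  g j := c • s.g j
  a := c • s.a
  monotone_f j := fun _ _ h => mul_le_mul_of_nonneg_left (s.monotone_f j h) hc
  monotone_g j := fun _ _ h => mul_le_mul_of_nonneg_left (s.monotone_g j h) hc
  a_nonpos i := mul_nonpos_of_nonneg_of_nonpos hc (s.a_nonpos i)

/-- The strategy consisting of the single long position `F` in the `j`-th coordinate. -/
noncomputable def long (j : Fin d) (F : ℝ →ᵇ ℝ) (hF : Monotone F) : Strategy d I where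
  f := Pi.single j F
  g := 0
  a := 0
  monotone_f k := by
    by_cases h : k = j
    · subst h; simpa using hF
    · rw [Pi.single_eq_of_ne h]
      exact fun _ _ _ => le_rfl
  monotone_g k := monotone_const
  a_nonpos i := le_rfl

/-- The strategy consisting of the single short position `G` in the `j`-th coordinate. -/
noncomputable def short (j : Fin d) (G : ℝ →ᵇ ℝ) (hG : Monotone G) : Strategy d I where
  f := 0
  g := Pi.single j G
  a := 0
  monotone_f k := monotone_const
  monotone_g k := by
    by_cases h : k = j
    · subst h; simpa using hG
    · rw [Pi.single_eq_of_ne h]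
      exact fun _ _ _ => le_rfl
  a_nonpos i := le_rfl

/-- The strategy consisting of one short position in the `i`-th box. -/
noncomputable def shortBox (i : I) : Strategy d I where
  f := 0
  g := 0
  a := Finsupp.single i (-1)
  monotone_f k := monotone_const
  monotone_g k := monotone_const
  a_nonpos k := by
    classical
    rw [Finsupp.single_apply]
    split_ifs <;> norm_num

section

variable (A : I → Fin d → ℝ) (νlo νhi : Fin d → ProbabilityMeasure ℝ) (πlo : I → ℝ)

theorem payoff_add (s t : Strategy d I) (x : Fin d → ℝ) :
    (s.add t).payoff A x = s.payoff A x + t.payoff A x := by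
  have h := Finsupp.sum_add_index' (f := s.a) (g := t.a)
    (h := fun i r => r * (lowerBox (A i)).indicator (fun _ => (1 : ℝ)) x)
    (fun _ => zero_mul _) (fun _ _ _ => add_mul _ _ _)
  simp only [Finsupp.sum] at h
  simp only [payoff, add, h, BoundedContinuousFunction.add_apply, Finset.sum_sub_distrib,
    Finset.sum_add_distrib]
  ring

theorem price_add (s t : Strategy d I) :
    (s.add t).price νlo νhi πlo = s.price νlo νhi πlo + t.price νlo νhi πlo := by
  have h := Finsupp.sum_add_index' (f := s.a) (g := t.a)
    (h := fun i r => r * πlo i) (fun _ => zero_mul _) (fun _ _ _ => add_mul _ _ _)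
  simp only [Finsupp.sum] at h
  simp only [price, add, h, BoundedContinuousFunction.add_apply,
    integral_add (BoundedContinuousFunction.integrable _ _)
      (BoundedContinuousFunction.integrable _ _),
    Finset.sum_sub_distrib, Finset.sum_add_distrib]
  ring

theorem payoff_scale (c : ℝ) (hc : 0 ≤ c) (s : Strategy d I) (x : Fin d → ℝ) :
    (s.scale c hc).payoff A x = c * s.payoff A x := by
  have h := Finsupp.sum_smul_index (g := s.a) (b := c)
    (h := fun i r => r * (lowerBox (A i)).indicator (fun _ => (1 : ℝ)) x) (fun _ => zero_mul _)
  simp only [Finsupp.sum] at h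
  simp only [payoff, scale, h, BoundedContinuousFunction.coe_smul, smul_eq_mul, mul_add,
    Finset.mul_sum, mul_sub, mul_assoc]

theorem price_scale (c : ℝ) (hc : 0 ≤ c) (s : Strategy d I) :
    (s.scale c hc).price νlo νhi πlo = c * s.price νlo νhi πlo := by
  have h := Finsupp.sum_smul_index (g := s.a) (b := c)
    (h := fun i r => r * πlo i) (fun _ => zero_mul _)
  simp only [Finsupp.sum] at h
  simp only [price, scale, h, BoundedContinuousFunction.coe_smul, smul_eq_mul, mul_add,
    Finset.mul_sum, mul_sub, mul_assoc, integral_const_mul]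

theorem payoff_long (j : Fin d) (F : ℝ →ᵇ ℝ) (hF : Monotone F) (x : Fin d → ℝ) :
    (long (I := I) j F hF).payoff A x = F (x j) := by
  simp only [payoff, long, Finsupp.support_zero, Finset.sum_empty, add_zero]
  rw [Finset.sum_eq_single j (fun k _ hk => by simp [hk]) (by simp)]
  simp

theorem price_long (j : Fin d) (F : ℝ →ᵇ ℝ) (hF : Monotone F) :
    (long (I := I) j F hF).price νlo νhi πlo = ∫ t, F t ∂(νhi j : Measure ℝ) := by
  simp only [price, long, Finsupp.support_zero, Finset.sum_empty, add_zero]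
  rw [Finset.sum_eq_single j (fun k _ hk => by simp [hk]) (by simp)]
  simp

theorem payoff_short (j : Fin d) (G : ℝ →ᵇ ℝ) (hG : Monotone G) (x : Fin d → ℝ) :
    (short (I := I) j G hG).payoff A x = -G (x j) := by
  simp only [payoff, short, Finsupp.support_zero, Finset.sum_empty, add_zero]
  rw [Finset.sum_eq_single j (fun k _ hk => by simp [hk]) (by simp)]
  simp

theorem price_short (j : Fin d) (G : ℝ →ᵇ ℝ) (hG : Monotone G) :
    (short (I := I) j G hG).price νlo νhi πlo = -∫ t, G t ∂(νlo j : Measure ℝ) := by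
  simp only [price, short, Finsupp.support_zero, Finset.sum_empty, add_zero]
  rw [Finset.sum_eq_single j (fun k _ hk => by simp [hk]) (by simp)]
  simp

theorem payoff_shortBox (i : I) (x : Fin d → ℝ) :
    (shortBox (d := d) i).payoff A x = -(lowerBox (A i)).indicator (fun _ => (1 : ℝ)) x := by
  simp [payoff, shortBox]

theorem price_shortBox (i : I) : (shortBox (d := d) i).price νlo νhi πlo = -πlo i := by
  simp [price, shortBox]

theorem monotone_bcf_const (c : ℝ) : Monotone (BoundedContinuousFunction.const ℝ c) :=
  fun _ _ _ => le_rfl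

/-- The strategy paying the constant `c`, as a long position in the `j`-th coordinate. -/
noncomputable def cash (j : Fin d) (c : ℝ) : Strategy d I :=
  long j (BoundedContinuousFunction.const ℝ c) (monotone_bcf_const c)

theorem payoff_cash (j : Fin d) (c : ℝ) (x : Fin d → ℝ) :
    (cash (I := I) j c).payoff A x = c := by
  rw [cash, payoff_long, BoundedContinuousFunction.const_apply]

theorem price_cash (j : Fin d) (c : ℝ) : (cash (I := I) j c).price νlo νhi πlo = c := by
  rw [cash, price_long]
  simp

end

end Strategy

/-! ### Hahn–Banach for the superhedging value -/

variable {d : ℕ} {I : Type*}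

/-- **Hahn–Banach**: if every strategy whose payoff is at least a constant costs at least that
constant, then there is a linear functional dominated by the superhedging value on bounded functions
and equal to it at a given bounded function. -/
theorem exists_linearMap_le_price (hd : 1 ≤ d) {νlo νhi : Fin d → ProbabilityMeasure ℝ}
    {A : I → Fin d → ℝ} {πlo : I → ℝ}
    (H : ∀ (s : Strategy d I) (c : ℝ), (∀ x, c ≤ s.payoff A x) → c ≤ s.price νlo νhi πlo)
    {f : (Fin d → ℝ) → ℝ} (hfb : ∃ C : ℝ, ∀ x, |f x| ≤ C) :
    ∃ Λ : ((Fin d → ℝ) → ℝ) →ₗ[ℝ] ℝ,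
      (∀ F, (∃ C : ℝ, ∀ x, |F x| ≤ C) → ∀ s ∈ Theta1 A F, Λ F ≤ s.price νlo νhi πlo) ∧
      ∀ m : ℝ, (∀ s ∈ Theta1 A f, m ≤ s.price νlo νhi πlo) → m ≤ Λ f := by
  let V : Submodule ℝ ((Fin d → ℝ) → ℝ) :=
    { carrier := {F | ∃ C : ℝ, ∀ x, |F x| ≤ C}
      add_mem' := by
        rintro F G ⟨C, hC⟩ ⟨D, hD⟩
        exact ⟨C + D, fun x => (abs_add_le _ _).trans (add_le_add (hC x) (hD x))⟩
      zero_mem' := ⟨0, fun x => by simp⟩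
      smul_mem' := by
        rintro c F ⟨C, hC⟩
        refine ⟨|c| * C, fun x => ?_⟩
        rw [Pi.smul_apply, smul_eq_mul, abs_mul]
        exact mul_le_mul_of_nonneg_left (hC x) (abs_nonneg c) }
  let S : V → Set ℝ := fun F => Strategy.price νlo νhi πlo '' Theta1 A (F : (Fin d → ℝ) → ℝ)
  -- This is a genuine infimum: cash makes `S F` nonempty, and `H` bounds it below.
  let N : V → ℝ := fun F => sInf (S F)
  have hne : ∀ F, (S F).Nonempty := by
    rintro ⟨F, C, hC⟩
    refine Set.Nonempty.image _ ⟨Strategy.cash ⟨0, hd⟩ C, fun x => ?_⟩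
    rw [Strategy.payoff_cash]
    exact (abs_le.1 (hC x)).2
  have hbdd : ∀ F, BddBelow (S F) := by
    rintro ⟨F, C, hC⟩
    refine ⟨-C, ?_⟩
    rintro _ ⟨s, hs, rfl⟩
    exact H s _ fun x => (abs_le.1 (hC x)).1.trans (hs x)
  have hNle : ∀ (F : V) (s : Strategy d I), s ∈ Theta1 A (F : (Fin d → ℝ) → ℝ) →
      N F ≤ s.price νlo νhi πlo := fun F s hs => csInf_le (hbdd F) ⟨s, hs, rfl⟩
  have hleN : ∀ (F : V) (m : ℝ), (∀ s ∈ Theta1 A (F : (Fin d → ℝ) → ℝ),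
      m ≤ s.price νlo νhi πlo) → m ≤ N F := by
    intro F m hm
    refine le_csInf (hne F) ?_
    rintro _ ⟨s, hs, rfl⟩
    exact hm s hs
  have N_add : ∀ F G, N (F + G) ≤ N F + N G := by
    intro F G
    rw [← sub_le_iff_le_add]
    refine hleN F _ fun s hs => ?_
    rw [sub_le_comm]
    refine hleN G _ fun t ht => ?_
    rw [sub_le_iff_le_add', ← Strategy.price_add]
    refine hNle _ _ fun x => ?_
    rw [Strategy.payoff_add]
    exact add_le_add (hs x) (ht x)
  have N_hom_le : ∀ c : ℝ, 0 < c → ∀ F, N (c • F) ≤ c * N F := by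
    intro c hc F
    rw [mul_comm, ← div_le_iff₀ hc]
    refine hleN F _ fun s hs => ?_
    rw [div_le_iff₀ hc, mul_comm, ← Strategy.price_scale _ _ _ c hc.le]
    refine hNle _ _ fun x => ?_
    rw [Strategy.payoff_scale]
    exact mul_le_mul_of_nonneg_left (hs x) hc.le
  have N_hom : ∀ c : ℝ, 0 < c → ∀ F, N (c • F) = c * N F := by
    intro c hc F
    refine le_antisymm (N_hom_le c hc F) ?_
    have := N_hom_le c⁻¹ (inv_pos.2 hc) (c • F)
    rw [smul_smul, inv_mul_cancel₀ hc.ne', one_smul] at this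
    rwa [← div_eq_inv_mul, le_div_iff₀' hc] at this
  have N_zero : N 0 = 0 := by
    have := N_hom 2 two_pos 0
    rw [smul_zero] at this
    linarith
  let f₀ : V := ⟨f, hfb⟩
  have hwd : ∀ c : ℝ, c • f₀ = 0 → c • N f₀ = 0 := by
    intro c hc
    rcases smul_eq_zero.1 hc with h | h
    · simp [h]
    · simp [h, N_zero]
  obtain ⟨g, hg, hgN⟩ := exists_extension_of_le_sublinear
    (LinearPMap.mkSpanSingleton' f₀ (N f₀) hwd) N N_hom N_add (by
      rintro ⟨x, hx⟩
      obtain ⟨c, rfl⟩ := Submodule.mem_span_singleton.1 hx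
      rw [LinearPMap.mkSpanSingleton'_apply]
      simp only [RingHom.id_apply, smul_eq_mul]
      rcases lt_trichotomy c 0 with hc | rfl | hc
      -- For negative `c`, subadditivity at `c • f₀` and its negative gives `0 ≤ N (c • f₀) - c * N
      -- f₀`.
      · have h1 := N_add (c • f₀) ((-c) • f₀)
        rw [← add_smul, add_neg_cancel, zero_smul, N_zero, N_hom (-c) (neg_pos.2 hc)] at h1
        linarith
      · simp [N_zero]
      · exact (N_hom c hc f₀).ge)
  -- This extension to unbounded functions is purely algebraic; domination is claimed only on
  -- bounded ones.
  obtain ⟨Λ, hΛ⟩ := LinearMap.exists_extend g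
  have hΛV : ∀ F : V, Λ F = g F := fun F => LinearMap.congr_fun hΛ F
  refine ⟨Λ, fun F hF s hs => ?_, fun m hm => ?_⟩
  · exact (hΛV ⟨F, hF⟩).le.trans ((hgN _).trans (hNle ⟨F, hF⟩ s hs))
  · have h1 : g f₀ = N f₀ := by
      exact (hg ⟨f₀, Submodule.mem_span_singleton_self f₀⟩).trans
        (LinearPMap.mkSpanSingleton'_apply_self f₀ (N f₀) hwd _)
    rw [show Λ f = N f₀ from (hΛV f₀).trans h1]
    exact hleN f₀ m hm

/-! ### Weak duality -/

theorem isClosed_lowerBox (b : Fin d → ℝ) : IsClosed (lowerBox b) := by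
  have : lowerBox b = Set.Iic b := rfl
  rw [this]
  exact isClosed_Iic

/-- Weak duality: the integral of `f` under a measure in `Q1` is at most the price of a strategy
dominating `f`. -/
theorem integral_le_price {νlo νhi : Fin d → ProbabilityMeasure ℝ} {A : I → Fin d → ℝ}
    {πlo : I → ℝ} {f : (Fin d → ℝ) → ℝ} (hf : Measurable f) (hfb : ∃ C : ℝ, ∀ x, |f x| ≤ C)
    {μ : ProbabilityMeasure (Fin d → ℝ)} (hμ : μ ∈ Q1 νlo νhi A πlo) {s : Strategy d I}
    (hs : s ∈ Theta1 A f) : ∫ x, f x ∂(μ : Measure (Fin d → ℝ)) ≤ s.price νlo νhi πlo := by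
  obtain ⟨C, hC⟩ := hfb
  have hmarg : ∀ j, IsProbabilityMeasure ((μ : Measure (Fin d → ℝ)).map (fun x => x j)) := fun j =>
    Measure.isProbabilityMeasure_map (measurable_pi_apply j).aemeasurable
  have hcoord : ∀ (j : Fin d) (F : ℝ →ᵇ ℝ), Integrable (fun x : Fin d → ℝ => F (x j))
      (μ : Measure (Fin d → ℝ)) := fun j F =>
    (F.compContinuous ⟨fun x : Fin d → ℝ => x j, continuous_apply j⟩).integrable _
  have hmap : ∀ (j : Fin d) (F : ℝ →ᵇ ℝ), ∫ x, F (x j) ∂(μ : Measure (Fin d → ℝ)) =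
      ∫ t, F t ∂((μ : Measure (Fin d → ℝ)).map (fun x => x j)) := fun j F =>
    (integral_map (measurable_pi_apply j).aemeasurable
      F.continuous.measurable.aestronglyMeasurable).symm
  have hbox : ∀ i, Integrable (fun x => s.a i * (lowerBox (A i)).indicator (fun _ => (1 : ℝ)) x)
      (μ : Measure (Fin d → ℝ)) := fun i =>
    ((integrable_const (1 : ℝ)).indicator (isClosed_lowerBox (A i)).measurableSet).const_mul _
  have hdiff : ∀ j, Integrable (fun x : Fin d → ℝ => s.f j (x j) - s.g j (x j))
      (μ : Measure (Fin d → ℝ)) := fun j => (hcoord j _).sub (hcoord j _)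
  have hsum1 : Integrable (fun x : Fin d → ℝ => ∑ j, (s.f j (x j) - s.g j (x j)))
      (μ : Measure (Fin d → ℝ)) :=
    integrable_finsetSum _ fun j _ => hdiff j
  have hsum2 := integrable_finsetSum s.a.support fun i _ => hbox i
  have hfint : Integrable f (μ : Measure (Fin d → ℝ)) :=
    Integrable.of_bound hf.aestronglyMeasurable C (Eventually.of_forall hC)
  calc ∫ x, f x ∂(μ : Measure (Fin d → ℝ))
      ≤ ∫ x, s.payoff A x ∂(μ : Measure (Fin d → ℝ)) :=
        integral_mono hfint (hsum1.add hsum2) hs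
    _ = ∑ j, (∫ x, s.f j (x j) ∂(μ : Measure (Fin d → ℝ)) -
          ∫ x, s.g j (x j) ∂(μ : Measure (Fin d → ℝ))) +
        ∑ i ∈ s.a.support, s.a i * (μ : Measure (Fin d → ℝ)).real (lowerBox (A i)) := by
        simp only [Strategy.payoff]
        rw [integral_add hsum1 hsum2, integral_finsetSum _ fun i _ => hbox i,
          integral_finsetSum _ fun j _ => hdiff j]
        congr 1
        · exact Finset.sum_congr rfl fun j _ => integral_sub (hcoord j _) (hcoord j _)
        · refine Finset.sum_congr rfl fun i _ => ?_
          rw [integral_const_mul]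
          congr 1
          exact integral_indicator_one (isClosed_lowerBox (A i)).measurableSet
    _ ≤ s.price νlo νhi πlo := by
        -- The signs match the constraints: `f_j` uses the upper marginal bound, `-g_j` the lower
        -- one, and `a i ≤ 0` reverses `μ(A^i) ≥ π̲^i`.
        refine add_le_add (Finset.sum_le_sum fun j _ => sub_le_sub ?_ ?_)
          (Finset.sum_le_sum fun i _ => mul_le_mul_of_nonpos_left (hμ.2 i) (s.a_nonpos i))
        · rw [hmap]
          exact (hμ.1 j).2.integral_le _ (s.monotone_f j)
        · rw [hmap]
          exact (hμ.1 j).1.integral_le _ (s.monotone_g j)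

/-! ### Tightness and construction of the measure -/

/-- The cutoff on `ℝ ^ d` that equals `1` on `[-n, n] ^ d` and vanishes outside
`[-n - 1, n + 1] ^ d`. -/
noncomputable def boxCutoff (d n : ℕ) : C_c(Fin d → ℝ, ℝ) where
  toFun x := max 0 (1 - ∑ j, (ramp 1 n (x j) + (1 - ramp 1 (-n - 1) (x j))))
  continuous_toFun := by fun_prop
  hasCompactSupport' := by
    refine HasCompactSupport.intro
      (isCompact_Icc : IsCompact (Set.Icc (fun _ : Fin d => (-n - 1 : ℝ)) fun _ => (n + 1 : ℝ))) ?_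
    intro x hx
    have hterm : ∀ j, 0 ≤ ramp 1 n (x j) + (1 - ramp 1 (-n - 1) (x j)) := fun j =>
      add_nonneg (ramp_nonneg _ _ _) (sub_nonneg.2 (ramp_le_one _ _ _))
    have : ∃ j, 1 ≤ ramp 1 n (x j) + (1 - ramp 1 (-n - 1) (x j)) := by
      by_contra! hcon
      refine hx ⟨fun j => ?_, fun j => ?_⟩
      · by_contra! hj
        have h1 := ramp_eq_zero zero_le_one hj.le
        have h2 := ramp_nonneg 1 n (x j)
        have h3 := hcon j
        rw [h1] at h3
        linarith
      · by_contra! hj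
        have h1 : ramp 1 n (x j) = 1 := ramp_eq_one (by linarith)
        have h2 := ramp_le_one 1 (-n - 1) (x j)
        have h3 := hcon j
        linarith
    obtain ⟨j, hj⟩ := this
    have := Finset.single_le_sum (fun k _ => hterm k) (Finset.mem_univ j)
    refine max_eq_left ?_
    linarith

theorem boxCutoff_apply (n : ℕ) (x : Fin d → ℝ) : boxCutoff d n x =
    max 0 (1 - ∑ j, (ramp 1 n (x j) + (1 - ramp 1 (-n - 1) (x j)))) := rfl

theorem boxCutoff_nonneg (n : ℕ) (x : Fin d → ℝ) : 0 ≤ boxCutoff d n x := le_max_left _ _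

theorem boxCutoff_le_one (n : ℕ) (x : Fin d → ℝ) : boxCutoff d n x ≤ 1 := by
  refine max_le zero_le_one (sub_le_self _ (Finset.sum_nonneg fun j _ => ?_))
  exact add_nonneg (ramp_nonneg _ _ _) (sub_nonneg.2 (ramp_le_one _ _ _))

theorem eventually_ramp_eq_zero (t : ℝ) : ∀ᶠ n : ℕ in atTop, ramp 1 n t = 0 := by
  obtain ⟨N, hN⟩ := exists_nat_ge t
  filter_upwards [eventually_ge_atTop N] with n hn
  exact ramp_eq_zero zero_le_one (hN.trans (by exact_mod_cast hn))

theorem eventually_ramp_eq_one (t : ℝ) : ∀ᶠ n : ℕ in atTop, ramp 1 (-n - 1) t = 1 := by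
  obtain ⟨N, hN⟩ := exists_nat_ge (-t)
  filter_upwards [eventually_ge_atTop N] with n hn
  have : (N : ℝ) ≤ n := by exact_mod_cast hn
  exact ramp_eq_one (by linarith)

theorem tendsto_boxCutoff (x : Fin d → ℝ) : Tendsto (fun n => boxCutoff d n x) atTop (𝓝 1) := by
  refine tendsto_const_nhds.congr' ?_
  filter_upwards [eventually_all.2 fun j => eventually_ramp_eq_zero (x j),
    eventually_all.2 fun j => eventually_ramp_eq_one (x j)] with n h0 h1
  simp [boxCutoff_apply, h0, h1]

theorem tendsto_integral_ramp_zero (ν : Measure ℝ) [IsProbabilityMeasure ν] :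
    Tendsto (fun n : ℕ => ∫ t, ramp 1 n t ∂ν) atTop (𝓝 0) := by
  have h := tendsto_integral_of_dominated_convergence (μ := ν) (f := fun _ => (0 : ℝ))
    (F := fun (n : ℕ) t => ramp 1 n t) (fun _ => 1)
    (fun n => (ramp 1 n).continuous.measurable.aestronglyMeasurable) (integrable_const _)
    (fun n => Eventually.of_forall fun t => by
      rw [Real.norm_eq_abs, abs_of_nonneg (ramp_nonneg _ _ _)]
      exact ramp_le_one _ _ _)
    (Eventually.of_forall fun t => tendsto_const_nhds.congr'
      ((eventually_ramp_eq_zero t).mono fun _ h => h.symm))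
  simpa using h

theorem tendsto_integral_ramp_one (ν : Measure ℝ) [IsProbabilityMeasure ν] :
    Tendsto (fun n : ℕ => ∫ t, ramp 1 (-n - 1) t ∂ν) atTop (𝓝 1) := by
  have h := tendsto_integral_of_dominated_convergence (μ := ν) (f := fun _ => (1 : ℝ))
    (F := fun (n : ℕ) t => ramp 1 (-n - 1) t) (fun _ => 1)
    (fun n => (ramp 1 (-n - 1)).continuous.measurable.aestronglyMeasurable) (integrable_const _)
    (fun n => Eventually.of_forall fun t => by
      rw [Real.norm_eq_abs, abs_of_nonneg (ramp_nonneg _ _ _)]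
      exact ramp_le_one _ _ _)
    (Eventually.of_forall fun t => tendsto_const_nhds.congr'
      ((eventually_ramp_eq_one t).mono fun _ h => h.symm))
  simpa using h

/-- A linear functional dominated by the prices of dominating strategies is dominated on bounded
upper semicontinuous functions by the integral under some measure in `Q1`. -/
theorem exists_mem_Q1_le_integral (hd : 1 ≤ d) {νlo νhi : Fin d → ProbabilityMeasure ℝ}
    {A : I → Fin d → ℝ} {πlo : I → ℝ} (Λ : ((Fin d → ℝ) → ℝ) →ₗ[ℝ] ℝ)
    (hΛ : ∀ F, (∃ C : ℝ, ∀ x, |F x| ≤ C) → ∀ s ∈ Theta1 A F, Λ F ≤ s.price νlo νhi πlo) :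
    ∃ μ ∈ Q1 νlo νhi A πlo, ∀ F : (Fin d → ℝ) → ℝ, (∃ C : ℝ, ∀ x, |F x| ≤ C) →
      UpperSemicontinuous F → Λ F ≤ ∫ x, F x ∂(μ : Measure (Fin d → ℝ)) := by
  have hconst : ∀ c : ℝ, Λ (fun _ => c) ≤ c := fun c => by
    have h := hΛ (fun _ => c) ⟨|c|, fun _ => le_rfl⟩
      (Strategy.cash ⟨0, hd⟩ c) (fun x => by rw [Strategy.payoff_cash])
    rwa [Strategy.price_cash] at h
  have hone : Λ (fun _ => 1) = 1 := by
    refine le_antisymm (hconst 1) ?_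
    have h := hconst (-1)
    rw [show (fun _ : Fin d → ℝ => (-1 : ℝ)) = -fun _ => 1 from rfl, map_neg] at h
    linarith
  have hpos : ∀ F : (Fin d → ℝ) → ℝ, (∃ C, ∀ x, |F x| ≤ C) → (∀ x, 0 ≤ F x) → 0 ≤ Λ F := by
    rintro F ⟨C, hC⟩ hF
    have h := hΛ (-F) ⟨C, fun x => by simpa using hC x⟩
      (Strategy.cash ⟨0, hd⟩ 0) (fun x => by rw [Strategy.payoff_cash]; simpa using hF x)
    rw [Strategy.price_cash, map_neg] at h
    simpa using h
  have hmono : ∀ F G : (Fin d → ℝ) → ℝ, (∃ C, ∀ x, |F x| ≤ C) → (∃ C, ∀ x, |G x| ≤ C) →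
      (∀ x, F x ≤ G x) → Λ F ≤ Λ G := by
    rintro F G ⟨C, hC⟩ ⟨D, hD⟩ hFG
    have h := hpos (G - F) ⟨D + C, fun x => (abs_sub _ _).trans (add_le_add (hD x) (hC x))⟩
      (fun x => sub_nonneg.2 (hFG x))
    rw [map_sub] at h
    linarith
  have hhi : ∀ (j : Fin d) (F : ℝ →ᵇ ℝ), Monotone F →
      Λ (fun x => F (x j)) ≤ ∫ t, F t ∂(νhi j : Measure ℝ) := fun j F hF => by
    rw [← Strategy.price_long (I := I) νlo νhi πlo j F hF]
    exact hΛ _ ⟨‖F‖, fun x => F.norm_coe_le_norm _⟩ _ fun x => by rw [Strategy.payoff_long]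
  have hlo : ∀ (j : Fin d) (F : ℝ →ᵇ ℝ), Monotone F →
      ∫ t, F t ∂(νlo j : Measure ℝ) ≤ Λ (fun x => F (x j)) := fun j F hF => by
    rw [← neg_le_neg_iff, ← Strategy.price_short (I := I) νlo νhi πlo j F hF, ← map_neg]
    refine hΛ _ ⟨‖F‖, fun x => ?_⟩ _ fun x => by rw [Strategy.payoff_short]; rfl
    rw [Pi.neg_apply, abs_neg]
    exact F.norm_coe_le_norm _
  have hΛχ : Tendsto (fun n => Λ (boxCutoff d n)) atTop (𝓝 1) := by
    have hlim : Tendsto (fun n : ℕ => 1 - ∑ j, (∫ t, ramp 1 n t ∂(νhi j : Measure ℝ) +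
        (1 - ∫ t, ramp 1 (-n - 1) t ∂(νlo j : Measure ℝ)))) atTop (𝓝 1) := by
      have h : Tendsto (fun n : ℕ => 1 - ∑ j, (∫ t, ramp 1 n t ∂(νhi j : Measure ℝ) +
          (1 - ∫ t, ramp 1 (-n - 1) t ∂(νlo j : Measure ℝ)))) atTop
          (𝓝 (1 - ∑ j : Fin d, ((0 : ℝ) + (1 - 1)))) :=
        (tendsto_finsetSum _ fun j _ => (tendsto_integral_ramp_zero _).add
          ((tendsto_integral_ramp_one _).const_sub 1)).const_sub 1
      simpa using h
    have hχb : ∀ n, ∃ C, ∀ x, |boxCutoff d n x| ≤ C := fun n => ⟨1, fun x => by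
      rw [abs_of_nonneg (boxCutoff_nonneg n x)]
      exact boxCutoff_le_one n x⟩
    refine tendsto_of_tendsto_of_tendsto_of_le_of_le hlim tendsto_const_nhds (fun n => ?_)
      (fun n => ?_)
    -- Without its `max`, the cutoff is a sum of one-coordinate terms, so `hhi` controls the upper
    -- tails and `hlo` the lower ones.
    · let T : (Fin d → ℝ) → ℝ := (fun _ => 1) - ∑ j : Fin d, ((fun x => ramp 1 n (x j)) +
        ((fun _ => 1) - fun x => ramp 1 (-n - 1) (x j)))
      have hT : ∀ x, T x = 1 - ∑ j, (ramp 1 n (x j) + (1 - ramp 1 (-n - 1) (x j))) := fun x => by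
        simp [T, Finset.sum_apply]
      have hTle : ∀ x, T x ≤ boxCutoff d n x := fun x => by
        rw [hT, boxCutoff_apply]
        exact le_max_right _ _
      have hTb : ∃ C, ∀ x, |T x| ≤ C := by
        refine ⟨1 + ∑ j : Fin d, 2, fun x => ?_⟩
        have h1 : ∑ j, (ramp 1 n (x j) + (1 - ramp 1 (-n - 1) (x j))) ≤ ∑ j : Fin d, (2 : ℝ) :=
          Finset.sum_le_sum fun j _ => by
            linarith [ramp_le_one 1 n (x j), ramp_nonneg 1 (-n - 1) (x j)]
        have h2 : 0 ≤ ∑ j, (ramp 1 n (x j) + (1 - ramp 1 (-n - 1) (x j))) :=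
          Finset.sum_nonneg fun j _ => by
            linarith [ramp_nonneg 1 n (x j), ramp_le_one 1 (-n - 1) (x j)]
        rw [hT, abs_le]
        constructor <;> linarith
      refine le_trans ?_ (hmono T _ hTb (hχb n) hTle)
      simp only [T, map_sub, map_sum, map_add, hone]
      refine sub_le_sub_left (Finset.sum_le_sum fun j _ => ?_) _
      exact add_le_add (hhi j _ (monotone_ramp zero_le_one))
        (sub_le_sub_left (hlo j _ (monotone_ramp zero_le_one)) _)
    · rw [← hone]
      exact hmono _ _ (hχb n) ⟨1, fun _ => by simp⟩ (boxCutoff_le_one n)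
  obtain ⟨μ, hμ⟩ := exists_probabilityMeasure_integral_eq Λ hpos hone (boxCutoff d)
    boxCutoff_nonneg boxCutoff_le_one tendsto_boxCutoff hΛχ
  have husc : ∀ F : (Fin d → ℝ) → ℝ, (∃ C : ℝ, ∀ x, |F x| ≤ C) →
      UpperSemicontinuous F → Λ F ≤ ∫ x, F x ∂(μ : Measure (Fin d → ℝ)) := fun F hF hFu =>
    le_integral_of_upperSemicontinuous hmono hμ hF hFu
  have hmap : ∀ (j : Fin d) (F : ℝ →ᵇ ℝ),
      ∫ t, F t ∂((μ : Measure (Fin d → ℝ)).map (fun x => x j)) = Λ (fun x => F (x j)) := by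
    intro j F
    rw [integral_map (measurable_pi_apply j).aemeasurable
      F.continuous.measurable.aestronglyMeasurable]
    exact hμ (F.compContinuous ⟨fun x : Fin d → ℝ => x j, continuous_apply j⟩)
  refine ⟨μ, ⟨fun j => ?_, fun i => ?_⟩, husc⟩
  · have : IsProbabilityMeasure ((μ : Measure (Fin d → ℝ)).map (fun x => x j)) :=
      Measure.isProbabilityMeasure_map (measurable_pi_apply j).aemeasurable
    constructor
    · exact firstOrderLE_of_integral_le fun F hF => by rw [hmap]; exact hlo j F hF
    · exact firstOrderLE_of_integral_le fun F hF => by rw [hmap]; exact hhi j F hF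
  · have hb : ∀ x, |(lowerBox (A i)).indicator (fun _ => (1 : ℝ)) x| ≤ 1 := fun x => by
      by_cases hx : x ∈ lowerBox (A i) <;> simp [hx]
    -- The box is closed, so its indicator is upper semicontinuous and `μ(A^i) ≥ Λ 1_{A^i}`.
    have h1 := husc ((lowerBox (A i)).indicator fun _ => 1) ⟨1, hb⟩
      ((isClosed_lowerBox (A i)).upperSemicontinuous_indicator zero_le_one)
    have h2 := hΛ (-(lowerBox (A i)).indicator fun _ => 1) ⟨1, fun x => by
      rw [Pi.neg_apply, abs_neg]; exact hb x⟩ (Strategy.shortBox i) fun x => by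
        rw [Strategy.payoff_shortBox]; rfl
    rw [Strategy.price_shortBox, map_neg, neg_le_neg_iff] at h2
    have h3 : ∫ x, (lowerBox (A i)).indicator (fun _ => (1 : ℝ)) x ∂(μ : Measure (Fin d → ℝ)) =
        (μ : Measure (Fin d → ℝ)).real (lowerBox (A i)) :=
      integral_indicator_one (isClosed_lowerBox (A i)).measurableSet
    rw [h3] at h1
    exact h2.trans h1

/-! ### Absence of arbitrage and conclusion -/

/-- If the superhedging value of every positive constant is positive, then a strategy whose payoff is
at least `c` costs at least `c`. -/
theorem le_price_of_le_payoff (hd : 1 ≤ d) {νlo νhi : Fin d → ProbabilityMeasure ℝ}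
    {A : I → Fin d → ℝ} {πlo : I → ℝ} (hφ : ∀ ε : ℝ, 0 < ε → 0 < phi1 νlo νhi A πlo fun _ => ε)
    (s : Strategy d I) (c : ℝ) (hs : ∀ x, c ≤ s.payoff A x) : c ≤ s.price νlo νhi πlo := by
  refine le_of_forall_pos_le_add fun ε hε => ?_
  -- Adding cash `ε - c` superhedges `ε`, so the total price `s.price + ε - c` is positive.
  have ht : s.add (Strategy.cash ⟨0, hd⟩ (ε - c)) ∈ Theta1 A fun _ => ε := fun x => by
    rw [Strategy.payoff_add, Strategy.payoff_cash]
    linarith [hs x]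
  have h := (hφ ε hε).trans_le (iInf₂_le _ ht)
  rw [EReal.coe_pos, Strategy.price_add, Strategy.price_cash] at h
  linarith

end FOSDDuality

theorem proposition2p6 {d : ℕ} (hd : 1 ≤ d) {I : Type*}
    (νlo νhi : Fin d → ProbabilityMeasure ℝ)
    (hν : ∀ j, FOSDDuality.FirstOrderLE (νlo j) (νhi j))
    (A : I → Fin d → ℝ) (πlo : I → ℝ) (hπ : ∀ i, 0 ≤ πlo i ∧ πlo i ≤ 1)
    (f : (Fin d → ℝ) → ℝ) (hf : UpperSemicontinuous f) (hfb : ∃ C : ℝ, ∀ x, |f x| ≤ C)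
    (hφ : ∀ ε : ℝ, 0 < ε → 0 < FOSDDuality.phi1 νlo νhi A πlo (fun _ => ε)) :
    FOSDDuality.phi1 νlo νhi A πlo f =
      ⨆ μ ∈ FOSDDuality.Q1 νlo νhi A πlo,
        ((∫ x, f x ∂(μ : Measure (Fin d → ℝ)) : ℝ) : EReal) := by
  refine le_antisymm ?_ (iSup₂_le fun μ hμ => le_iInf₂ fun s hs =>
    EReal.coe_le_coe_iff.2 (FOSDDuality.integral_le_price hf.measurable hfb hμ hs))
  obtain ⟨Λ, hΛ, hΛf⟩ := FOSDDuality.exists_linearMap_le_price hd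
    (FOSDDuality.le_price_of_le_payoff hd hφ) hfb
  obtain ⟨μ, hμ, hμu⟩ := FOSDDuality.exists_mem_Q1_le_integral hd Λ hΛ
  refine le_trans ?_ (le_iSup₂_of_le μ hμ (EReal.coe_le_coe_iff.2 (hμu f hfb hf)))
  -- Testing against real `m` below the extended-real infimum lets the real-valued bound `hΛf`
  -- apply.
  refine EReal.ge_of_forall_gt_iff_ge.1 fun m hm => ?_
  refine EReal.coe_le_coe_iff.2 (hΛf m fun s hs => ?_)
  exact EReal.coe_le_coe_iff.1 (hm.le.trans (iInf₂_le s hs))
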